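/- Let $n\ge 1$ and $\ell\ge 3$ be integers. The Sierpiński graph $S(n,\ell)$ has as vertices all words $u=u_0u_1\cdots u_{n-1}$ of length $n$ over $\{0,1,\dots,\ell-1\}$; two words $u,v$ are adjacent if and only if there is $d\in\{0,1,\dots,n-1\}$ such that $u_j=v_j$ for all $j<d$, $u_d\neq v_d$, and $u_j=v_d$ and $v_j=u_d$ for all $j>d$. For a finite simple graph $G$ and $S\subseteq V(G)$ with $|S|\ge 2$, an $S$-Steiner tree is a subgraph of $G$ that is a tree and whose vertex set contains $S$. Let $\lambda_G(S)$ be the maximum number of pairwise edge-disjoint $S$-Steiner trees in $G$, and let $\kappa_G(S)$ be the maximum number of internally disjoint ones, that is, $S$-Steiner trees $T_1,\dots,T_m$ with $E(T_i)\cap E(T_j)=\emptyset$ and $V(T_i)\cap V(T_j)=S$ for all $i\ne j$. For $2\le k\le |V(G)|$ put $$\kappa_k(G)=\min\{\kappa_G(S): S\subseteq V(G),\ |S|=k\},\qquad \lambda_k(G)=\min\{\lambda_G(S): S\subseteq V(G),\ |S|=k\}.$$ Then the following hold. (i) For every integer $k$ with $3\le k\le \ell$, $$\kappa_k(S(n,\ell))=\lambda_k(S(n,\ell))=\ell-\lceil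 k/2\rceil .$$ (ii) For every integer $k$ with $\ell+1\le k\le \ell^n$, $$\kappa_k(S(n,\ell))\le\lfloor \ell/2\rfloor\qquad\text{and}\qquad \lambda_k(S(n,\ell))=\lfloor \ell/2\rfloor .$$ -/

import Mathlib

namespace SteinerPacking

variable {V : Type*}

/-- `T` is an `S`-Steiner tree of `G`: a subgraph of `G` that is a tree and contains `S`. -/
def IsSteinerTree (G : SimpleGraph V) (S : Finset V) (T : G.Subgraph) : Prop :=
  T.coe.IsTree ∧ (S : Set V) ⊆ T.verts

/-- `T 0, …, T (m - 1)` are pairwise edge-disjoint `S`-Steiner trees of `G`. -/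
def EdgeDisjointTrees (G : SimpleGraph V) (S : Finset V) {m : ℕ}
    (T : Fin m → G.Subgraph) : Prop :=
  (∀ i, IsSteinerTree G S (T i)) ∧
    ∀ i j, i ≠ j → (T i).edgeSet ∩ (T j).edgeSet = ∅

/-- `T 0, …, T (m - 1)` are internally disjoint `S`-Steiner trees of `G`: pairwise edge-disjoint,
and any two of them have exactly the vertices of `S` in common. -/
def InternallyDisjointTrees (G : SimpleGraph V) (S : Finset V) {m : ℕ}
    (T : Fin m → G.Subgraph) : Prop :=
  (∀ i, IsSteinerTree G S (T i)) ∧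
    ∀ i j, i ≠ j →
      (T i).edgeSet ∩ (T j).edgeSet = ∅ ∧ (T i).verts ∩ (T j).verts = (S : Set V)

/-- `κ_G(S)`: the maximum number of internally disjoint `S`-Steiner trees of `G`. -/
noncomputable def localConn (G : SimpleGraph V) (S : Finset V) : ℕ∞ :=
  sSup {x : ℕ∞ | ∃ m : ℕ, x = m ∧ ∃ T : Fin m → G.Subgraph, InternallyDisjointTrees G S T}

/-- `λ_G(S)`: the maximum number of edge-disjoint `S`-Steiner trees of `G`. -/
noncomputable def localEdgeConn (G : SimpleGraph V) (S : Finset V) : ℕ∞ :=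
  sSup {x : ℕ∞ | ∃ m : ℕ, x = m ∧ ∃ T : Fin m → G.Subgraph, EdgeDisjointTrees G S T}

/-- The generalized `k`-connectivity `κ_k(G)`: the minimum of `κ_G(S)` over the vertex sets `S`
with `k` elements. -/
noncomputable def genConn (k : ℕ) (G : SimpleGraph V) : ℕ∞ :=
  sInf {x : ℕ∞ | ∃ S : Finset V, S.card = k ∧ x = localConn G S}

/-- The generalized `k`-edge-connectivity `λ_k(G)`: the minimum of `λ_G(S)` over the vertex sets
`S` with `k` elements. -/
noncomputable def genEdgeConn (k : ℕ) (G : SimpleGraph V) : ℕ∞ :=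
  sInf {x : ℕ∞ | ∃ S : Finset V, S.card = k ∧ x = localEdgeConn G S}

/-- The Sierpiński graph `S(n, ℓ)` on the words of length `n` over `{0, …, ℓ - 1}`: `u` and `v`
are adjacent iff for some position `d` they agree before `d`, differ at `d`, and after `d` the
word `u` is constantly `v d` and the word `v` is constantly `u d`. -/
def sierpinskiGraph (n ℓ : ℕ) : SimpleGraph (Fin n → Fin ℓ) where
  Adj u v := ∃ d : Fin n,
    (∀ j, j < d → u j = v j) ∧ u d ≠ v d ∧ ∀ j, d < j → u j = v d ∧ v j = u d
  symm := ⟨fun _ _ ⟨d, h₁, h₂, h₃⟩ =>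
    ⟨d, fun j hj => (h₁ j hj).symm, h₂.symm, fun j hj => ⟨(h₃ j hj).2, (h₃ j hj).1⟩⟩⟩
  loopless := ⟨fun _ ⟨_, _, h, _⟩ => h rfl⟩

end SteinerPacking

/-! Lower bounds: `S(n+1, ℓ)` arises from `S(n, ℓ)` by replacing each vertex `w` by a clique on the
words `w a`, each old edge being attached at the clique vertex named by its port. A packing is
therefore a colouring of ports, and it lifts one level by colouring the edges of every clique
(`IsPortPacking.lift`). In a clique with terminal set `A`, each of the `ℓ - |A|` other vertices is
the hub of a star on `A`, and `A` itself splits off `⌊|A|/2⌋` zigzag paths: `ℓ - ⌈|A|/2⌉` connectors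
in all. A colour with a port outside `A` takes that vertex as hub; the others need a spare
connector.

The induction for `|S| ≤ ℓ` starts from the projection `S'` of `S`, which allows at least as many
colours, and discards the surplus. It also keeps one uncoloured port at every terminal; without it
the count of connectors can fall short by one (`exists_thinned_packing`). For spanning trees, the
`⌊ℓ/2⌋` zigzags of every clique suffice.

Upper bounds: contracting the words with equal first letter gives `K_ℓ`, with a single edge between
any two letters. Edge-disjoint trees whose terminals meet `r` classes become edge-disjoint subgraphs
connecting `r` vertices of `K_ℓ`, and a weighted edge count allows at most `ℓ - ⌈r/2⌉` of them
(`le_of_disjoint_connecting`). -/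

namespace SteinerPacking

open Relation

/-! ### Ports, and lifting a packing by one letter -/

/-- The edge of the Sierpiński graph between `w` and `w'` leaves `w` through the port `i` and
enters `w'` through the port `i'`: the words `w i` and `w' i'` are adjacent one level up. -/
def PortAdj {n ℓ : ℕ} (w : Fin n → Fin ℓ) (i : Fin ℓ) (w' : Fin n → Fin ℓ) (i' : Fin ℓ) : Prop :=
  ∃ d : Fin n, (∀ j, j < d → w j = w' j) ∧ w d ≠ w' d ∧
    (∀ j, d < j → w j = w' d ∧ w' j = w d) ∧ i = w' d ∧ i' = w d

/-- One step along an edge whose starting port is marked by `R`. -/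
def PortStep {n ℓ : ℕ} (R : (Fin n → Fin ℓ) → Fin ℓ → Prop) (w w' : Fin n → Fin ℓ) : Prop :=
  ∃ i i', PortAdj w i w' i' ∧ R w i

/-- `U j w i` says that the port `i` of `w` is used by the `j`-th of `m` connected pieces, which
contain `S`, have no common edge, and have no common vertex outside `S`. -/
structure IsPortPacking {n ℓ m : ℕ} (S : Finset (Fin n → Fin ℓ))
    (U : Fin m → (Fin n → Fin ℓ) → Fin ℓ → Prop) : Prop where
  symm : ∀ j w i w' i', PortAdj w i w' i' → U j w i → U j w' i'
  excl : ∀ j j' w i, U j w i → U j' w i → j = j'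
  disj : ∀ j j' w i i', w ∉ S → U j w i → U j' w i' → j = j'
  conn : ∀ j, ∀ w ∈ S, ∀ w' ∈ S, ReflTransGen (PortStep (U j)) w w'

/-- `c` extends the colouring `p` of the ports of a clique (placed on the diagonal) to its edges,
so that each colour class connects its ports with the set `A` of terminals. -/
structure IsCliqueFilling {ℓ m : ℕ} (A : Finset (Fin ℓ)) (p : Fin m → Fin ℓ → Prop)
    (c : Fin m → Fin ℓ → Fin ℓ → Prop) : Prop where
  symm : ∀ j a b, c j a b → c j b a
  diag : ∀ j a, c j a a ↔ p j a
  excl : ∀ j j' a b, c j a b → c j' a b → j = j'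
  disj : ∀ j j' a b b', a ∉ A → c j a b → c j' a b' → j = j'
  conn : ∀ j x y, (x ∈ A ∨ p j x) → (y ∈ A ∨ p j y) → ReflTransGen (c j) x y

theorem PortAdj.of_init_eq {n ℓ : ℕ} {u v : Fin (n + 1) → Fin ℓ} (h : Fin.init u = Fin.init v)
    (hne : u (Fin.last n) ≠ v (Fin.last n)) :
    PortAdj u (v (Fin.last n)) v (u (Fin.last n)) := by
  refine ⟨Fin.last n, fun j hj => ?_, hne, fun j hj => absurd hj (not_lt.2 (Fin.le_last j)),
    rfl, rfl⟩
  obtain ⟨j, rfl⟩ := Fin.exists_castSucc_eq.2 hj.ne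
  exact congrFun h j

theorem PortAdj.lift {n ℓ : ℕ} {u v : Fin (n + 1) → Fin ℓ}
    (h : PortAdj (Fin.init u) (u (Fin.last n)) (Fin.init v) (v (Fin.last n))) :
    PortAdj u (u (Fin.last n)) v (v (Fin.last n)) := by
  obtain ⟨d, h₁, h₂, h₃, h₄, h₅⟩ := h
  refine ⟨d.castSucc, fun j hj => ?_, h₂, fun j hj => ?_, h₄, h₅⟩
  · obtain ⟨j, rfl⟩ := Fin.exists_castSucc_eq.2 (hj.trans_le (Fin.le_last _)).ne
    exact h₁ j hj
  · induction j using Fin.lastCases with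
    | last => exact ⟨h₄, h₅⟩
    | cast j => exact h₃ j hj

theorem PortAdj.cases_init {n ℓ : ℕ} {u v : Fin (n + 1) → Fin ℓ} {i i' : Fin ℓ}
    (h : PortAdj u i v i') :
    (Fin.init u = Fin.init v ∧ i = v (Fin.last n) ∧ i' = u (Fin.last n)) ∨
      (PortAdj (Fin.init u) (u (Fin.last n)) (Fin.init v) (v (Fin.last n)) ∧
        i = u (Fin.last n) ∧ i' = v (Fin.last n)) := by
  obtain ⟨d, h₁, h₂, h₃, h₄, h₅⟩ := h
  induction d using Fin.lastCases with
  | last => exact Or.inl ⟨funext fun j => h₁ _ (Fin.castSucc_lt_last j), h₄, h₅⟩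
  | cast d =>
    have hl := h₃ (Fin.last n) (Fin.castSucc_lt_last d)
    refine Or.inr ⟨⟨d, fun j hj => h₁ _ hj, h₂, fun j hj => h₃ _ hj, hl.1, hl.2⟩, ?_, ?_⟩
    · rw [h₄, hl.1]
    · rw [h₅, hl.2]

/-- The position `d` is the first difference of the two words, so an edge determines its ports.
Hence exclusive colours on ports give edge-disjoint subgraphs. -/
theorem PortAdj.eq_of_eq {n ℓ : ℕ} {w w' : Fin n → Fin ℓ} {a a' b b' : Fin ℓ}
    (h : PortAdj w a w' a') (h' : PortAdj w b w' b') : a = b := by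
  obtain ⟨d, h₁, h₂, -, rfl, -⟩ := h
  obtain ⟨e, g₁, g₂, -, rfl, -⟩ := h'
  rcases lt_trichotomy d e with hd | rfl | hd
  · exact absurd (g₁ d hd) h₂
  · rfl
  · exact absurd (h₁ e hd) g₂

theorem PortAdj.symm {n ℓ : ℕ} {w w' : Fin n → Fin ℓ} {a a' : Fin ℓ}
    (h : PortAdj w a w' a') : PortAdj w' a' w a := by
  obtain ⟨d, h₁, h₂, h₃, h₄, h₅⟩ := h
  exact ⟨d, fun j hj => (h₁ j hj).symm, h₂.symm, fun j hj => (h₃ j hj).symm, h₅, h₄⟩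

theorem PortAdj.adj {n ℓ : ℕ} {w w' : Fin n → Fin ℓ} {a a' : Fin ℓ}
    (h : PortAdj w a w' a') : (sierpinskiGraph n ℓ).Adj w w' := by
  obtain ⟨d, h₁, h₂, h₃, -⟩ := h
  exact ⟨d, h₁, h₂, h₃⟩

/-- The terminals inside the clique that replaces the vertex `w`. -/
def cliqueTerminals {n ℓ : ℕ} (S : Finset (Fin (n + 1) → Fin ℓ)) (w : Fin n → Fin ℓ) :
    Finset (Fin ℓ) :=
  Finset.univ.filter fun a => (Fin.snoc w a : Fin (n + 1) → Fin ℓ) ∈ S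

theorem mem_cliqueTerminals_init {n ℓ : ℕ} {S : Finset (Fin (n + 1) → Fin ℓ)}
    {u : Fin (n + 1) → Fin ℓ} : u (Fin.last n) ∈ cliqueTerminals S (Fin.init u) ↔ u ∈ S := by
  simp [cliqueTerminals, Fin.snoc_init_self]

/-- Filling every clique extends a port packing one level up. -/
theorem IsPortPacking.lift {n ℓ m : ℕ} {S : Finset (Fin (n + 1) → Fin ℓ)}
    {S' : Finset (Fin n → Fin ℓ)} (hS : ∀ u ∈ S, Fin.init u ∈ S')
    {U : Fin m → (Fin n → Fin ℓ) → Fin ℓ → Prop} (hU : IsPortPacking S' U)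
    {c : (Fin n → Fin ℓ) → Fin m → Fin ℓ → Fin ℓ → Prop}
    (hc : ∀ w, IsCliqueFilling (cliqueTerminals S w) (fun j => U j w) (c w)) :
    IsPortPacking S (fun j u b => c (Fin.init u) j (u (Fin.last n)) b) := by
  set N : Fin m → (Fin (n + 1) → Fin ℓ) → Fin ℓ → Prop :=
    fun j u b => c (Fin.init u) j (u (Fin.last n)) b with hN
  have hclique : ∀ j w a b, ReflTransGen (c w j) a b →
      ReflTransGen (PortStep (N j)) (Fin.snoc w a) (Fin.snoc w b) := by
    intro j w a b h
    induction h with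
    | refl => exact .refl
    | @tail x y _ hxy ih =>
      -- A diagonal entry of `c` marks a port, not an edge of the clique, so it contributes no step.
      by_cases hne : x = y
      · rwa [← hne]
      · refine ih.tail ⟨y, x, ?_, by simpa [hN] using hxy⟩
        simpa using PortAdj.of_init_eq (u := (Fin.snoc w x : Fin (n + 1) → Fin ℓ))
          (v := Fin.snoc w y) (by simp) (by simpa using hne)
  -- The end `y` is arbitrary so that, in the induction, it can be the port through which the next
  -- edge leaves.
  have hpath : ∀ j w w', ReflTransGen (PortStep (U j)) w w' → ∀ y,
      (y ∈ cliqueTerminals S w' ∨ U j w' y) → ∀ x, (x ∈ cliqueTerminals S w ∨ U j w x) →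
      ReflTransGen (PortStep (N j)) (Fin.snoc w x) (Fin.snoc w' y) := by
    intro j w w' h
    induction h with
    | refl => exact fun y hy x hx => hclique _ _ _ _ ((hc w).conn j x y hx hy)
    | @tail v v' _ hv ih =>
      intro y hy x hx
      obtain ⟨i, i', hp, hi⟩ := hv
      have hi' := hU.symm _ _ _ _ _ hp hi
      refine ((ih i (Or.inr hi) x hx).tail ⟨i, i', ?_, ?_⟩).trans
        (hclique _ _ _ _ ((hc v').conn j i' y (Or.inr hi') hy))
      · simpa using PortAdj.lift (u := (Fin.snoc v i : Fin (n + 1) → Fin ℓ))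
          (v := Fin.snoc v' i') (by simpa using hp)
      · simpa [hN] using ((hc v).diag j i).2 hi
  refine ⟨?_, ?_, ?_, ?_⟩
  · intro j u i v i' hp hu
    rcases hp.cases_init with ⟨h, rfl, rfl⟩ | ⟨h, rfl, rfl⟩
    · have := (hc _).symm _ _ _ hu
      rw [h] at this
      exact this
    · exact ((hc _).diag _ _).2 (hU.symm _ _ _ _ _ h (((hc _).diag _ _).1 hu))
  · exact fun j j' u i h h' => (hc _).excl _ _ _ _ h h'
  · exact fun j j' u i i' hu h h' =>
      (hc _).disj _ _ _ _ _ (fun h => hu (mem_cliqueTerminals_init.1 h)) h h'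
  · intro j u hu v hv
    have := hpath j _ _ (hU.conn j _ (hS u hu) _ (hS v hv)) _
      (Or.inl (mem_cliqueTerminals_init.2 hv)) _ (Or.inl (mem_cliqueTerminals_init.2 hu))
    simpa [Fin.snoc_init_self] using this

/-! ### Zigzag paths in a complete graph -/

/-- `e` numbers the elements of `A` by `0, …, s - 1`. -/
structure IsNumbering {α : Type*} (A : Finset α) (s : ℕ) (e : α → ℕ) : Prop where
  lt : ∀ a ∈ A, e a < s
  inj : ∀ a ∈ A, ∀ b ∈ A, e a = e b → a = b
  surj : ∀ i < s, ∃ a ∈ A, e a = i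

theorem exists_isNumbering {α : Type*} {A : Finset α} {a₀ : α} (ha : a₀ ∈ A)
    {i : ℕ} (hi : i < A.card) : ∃ e : α → ℕ, IsNumbering A A.card e ∧ e a₀ = i := by
  classical
  set f : A ≃ Fin A.card := A.equivFin.trans (Equiv.swap (A.equivFin ⟨a₀, ha⟩) ⟨i, hi⟩) with hf
  refine ⟨fun a => if h : a ∈ A then (f ⟨a, h⟩ : ℕ) else 0, ⟨?_, ?_, ?_⟩, ?_⟩
  · intro a h
    simp [h]
  · intro a h b h' hab
    simp only [h, h', dif_pos] at hab
    exact congrArg Subtype.val (f.injective (Fin.ext hab))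
  · intro i hi
    refine ⟨f.symm ⟨i, hi⟩, (f.symm ⟨i, hi⟩).2, ?_⟩
    simp
  · simp [ha, hf]

theorem IsNumbering.exists_partner {α : Type*} {A : Finset α} {s : ℕ} {e : α → ℕ}
    (he : IsNumbering A s e) {a : α} (ha : a ∈ A) {v : ℕ} (hv : v < s) :
    ∃ b ∈ A, (e a + e b = v ∨ e a + e b = v + s) ∧ (e a + e b) % s = v := by
  have h := he.lt a ha
  obtain ⟨b, hb, hb'⟩ : ∃ b ∈ A, e a + e b = v ∨ e a + e b = v + s := by
    rcases le_or_gt (e a) v with h' | h'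
    · obtain ⟨b, hb, hb'⟩ := he.surj (v - e a) (by omega)
      exact ⟨b, hb, by omega⟩
    · obtain ⟨b, hb, hb'⟩ := he.surj (v + s - e a) (by omega)
      exact ⟨b, hb, by omega⟩
  refine ⟨b, hb, hb', ?_⟩
  rcases hb' with h | h <;> rw [h]
  · exact Nat.mod_eq_of_lt hv
  · rw [Nat.add_mod_right, Nat.mod_eq_of_lt hv]

/-- The pairs whose numbers add up to `2 t` or `2 t + 1` modulo `s` connect a complete graph. -/
theorem IsNumbering.zigzag {α : Type*} {A : Finset α} {s : ℕ} {e : α → ℕ}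
    (he : IsNumbering A s e) {t : ℕ} (ht : t < s / 2) {r : α → α → Prop}
    (hr : ∀ a ∈ A, ∀ b ∈ A, a ≠ b → (e a + e b) % s / 2 = t → r a b)
    {x y : α} (hx : x ∈ A) (hy : y ∈ A) : ReflTransGen r x y := by
  have hr' : ∀ a ∈ A, ∀ b ∈ A, (e a + e b) % s / 2 = t →
      ReflTransGen r a b ∧ ReflTransGen r b a := by
    intro a ha b hb h
    by_cases hab : a = b
    · subst hab
      exact ⟨.refl, .refl⟩
    · exact ⟨.single (hr a ha b hb hab h),
        .single (hr b hb a ha (Ne.symm hab) (by rwa [add_comm]))⟩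
  -- Passing to the partner with sum `2t` and then to the partner with sum `2t + 1` raises the
  -- number by one modulo `s`.
  have hstep : ∀ a ∈ A, ∀ b ∈ A, e b = e a + 1 → ReflTransGen r a b ∧ ReflTransGen r b a := by
    intro a ha b hb hab
    obtain ⟨c, hc, hc', hc''⟩ := he.exists_partner ha (v := 2 * t) (by omega)
    obtain ⟨d, hd, hd', hd''⟩ := he.exists_partner hc (v := 2 * t + 1) (by omega)
    have hdb : d = b := by
      apply he.inj d hd b hb
      have := he.lt b hb
      have := he.lt a ha
      have := he.lt d hd
      omega
    subst hdb
    have h₁ := hr' a ha c hc (by omega)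
    have h₂ := hr' c hc d hd (by omega)
    exact ⟨h₁.1.trans h₂.1, h₂.2.trans h₁.2⟩
  have hle : ∀ k, ∀ a ∈ A, ∀ b ∈ A, e b = e a + k →
      ReflTransGen r a b ∧ ReflTransGen r b a := by
    intro k
    induction k with
    | zero =>
      intro a ha b hb h
      rw [he.inj b hb a ha h]
      exact ⟨.refl, .refl⟩
    | succ k ih =>
      intro a ha b hb h
      obtain ⟨c, hc, hc'⟩ := he.surj (e a + k) (by have := he.lt b hb; omega)
      have h₁ := ih a ha c hc hc'
      have h₂ := hstep c hc b hb (by omega)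
      exact ⟨h₁.1.trans h₂.1, h₂.2.trans h₁.2⟩
  rcases le_total (e x) (e y) with h | h
  · exact (hle (e y - e x) x hx y hy (by omega)).1
  · exact (hle (e x - e y) y hy x hx (by omega)).2

/-! ### Filling one clique -/

theorem isCliqueFilling_complete {ℓ m : ℕ} {A : Finset (Fin ℓ)} {p : Fin m → Fin ℓ → Prop}
    (hA : A = ∅) (hp : ∀ j j' a b, p j a → p j' b → j = j') :
    IsCliqueFilling A p (fun j a b => p j a ∧ p j b) := by
  subst hA
  refine ⟨fun j a b h => h.symm, fun j a => and_self_iff, fun j j' a b h h' => hp _ _ _ _ h.1 h'.1,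
    fun j j' a b b' _ h h' => hp _ _ _ _ h.1 h'.1, fun j x y hx hy => .single ?_⟩
  simp only [Finset.notMem_empty, false_or] at hx hy
  exact ⟨hx, hy⟩

/-- The only terminal is the hub of every colour; the edge from it to `b` inherits the colour of the
port `b`, so no two colours compete. -/
theorem isCliqueFilling_star {ℓ m : ℕ} {a₀ : Fin ℓ} {p : Fin m → Fin ℓ → Prop}
    (hp : ∀ j j' a, p j a → p j' a → j = j') :
    IsCliqueFilling {a₀} p
      (fun j a b => (a = b ∧ p j a) ∨ (a ≠ b ∧ ((a = a₀ ∧ p j b) ∨ (b = a₀ ∧ p j a)))) := by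
  have hsymm : ∀ j a b, ((a = b ∧ p j a) ∨ (a ≠ b ∧ ((a = a₀ ∧ p j b) ∨ (b = a₀ ∧ p j a)))) →
      ((b = a ∧ p j b) ∨ (b ≠ a ∧ ((b = a₀ ∧ p j a) ∨ (a = a₀ ∧ p j b)))) := by
    rintro j a b (⟨rfl, h⟩ | ⟨hne, h⟩)
    · exact Or.inl ⟨rfl, h⟩
    · exact Or.inr ⟨hne.symm, h.symm⟩
  refine ⟨hsymm, fun j a => by simp, ?_, ?_, ?_⟩
  · rintro j j' a b (⟨rfl, h⟩ | ⟨hne, ⟨rfl, h⟩ | ⟨rfl, h⟩⟩) (⟨h₁, h'⟩ | ⟨hne', ⟨h₁, h'⟩ | ⟨h₁, h'⟩⟩)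
    all_goals first | exact hp _ _ _ h h' | (subst h₁; contradiction)
  · intro j j' a b b' ha h h'
    have ha : a ≠ a₀ := by simpa using ha
    refine hp _ _ a ?_ ?_
    · rcases h with h | ⟨-, h | h⟩
      exacts [h.2, absurd h.1 ha, h.2]
    · rcases h' with h | ⟨-, h | h⟩
      exacts [h.2, absurd h.1 ha, h.2]
  · intro j
    have key : ∀ x, (x ∈ ({a₀} : Finset (Fin ℓ)) ∨ p j x) → x ≠ a₀ → p j x := by
      intro x hx hne
      exact hx.resolve_left (by simpa using hne)
    intro x y hx hy
    refine ReflTransGen.trans (b := a₀) ?_ ?_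
    · by_cases h : x = a₀
      · rw [h]
      · exact .single (Or.inr ⟨h, Or.inr ⟨rfl, key x hx h⟩⟩)
    · by_cases h : y = a₀
      · rw [h]
      · exact .single (Or.inr ⟨Ne.symm h, Or.inl ⟨rfl, key y hy h⟩⟩)

/-- Colours are assigned to connectors of the terminals `A` in a clique: vertices outside `A`, and
connected spanning subgraphs of `A`. -/
structure IsSlotting {ℓ m s : ℕ} (A : Finset (Fin ℓ)) (p : Fin m → Fin ℓ → Prop)
    (slot : Fin m → Fin ℓ ⊕ Fin s) : Prop where
  inj : Function.Injective slot
  inl : ∀ j b, slot j = Sum.inl b → b ∉ A ∧ ∀ j', p j' b → j' = j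
  inr : ∀ j t, slot j = Sum.inr t → ∀ b, p j b → b ∈ A

/-- The colouring of a clique that belongs to an assignment of connectors. -/
def slotColoring {ℓ m s : ℕ} (A : Finset (Fin ℓ)) (p : Fin m → Fin ℓ → Prop)
    (slot : Fin m → Fin ℓ ⊕ Fin s) (e : Fin ℓ → ℕ) (j : Fin m) (a b : Fin ℓ) : Prop :=
  (a = b ∧ p j a) ∨ (a ≠ b ∧ ((slot j = Sum.inl b ∧ (a ∈ A ∨ p j a)) ∨
    (slot j = Sum.inl a ∧ (b ∈ A ∨ p j b)) ∨
    ∃ t : Fin s, slot j = Sum.inr t ∧ a ∈ A ∧ b ∈ A ∧ (e a + e b) % A.card / 2 = t))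

theorem slotColoring_self {ℓ m s : ℕ} {A : Finset (Fin ℓ)} {p : Fin m → Fin ℓ → Prop}
    {slot : Fin m → Fin ℓ ⊕ Fin s} {e : Fin ℓ → ℕ} {j : Fin m} {a : Fin ℓ} :
    slotColoring A p slot e j a a ↔ p j a := by
  simp [slotColoring]

/-- Outside `A` a vertex meets only the colour of its port and the colour whose hub it is, and these
agree when both exist. Edges inside `A` belong to zigzags, which are separated by the residue of the
sum. -/
theorem IsSlotting.isCliqueFilling {ℓ m : ℕ} {A : Finset (Fin ℓ)} {p : Fin m → Fin ℓ → Prop}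
    {slot : Fin m → Fin ℓ ⊕ Fin (A.card / 2)} (hs : IsSlotting A p slot) {e : Fin ℓ → ℕ}
    (he : IsNumbering A A.card e) (hp : ∀ j j' a, p j a → p j' a → j = j') :
    IsCliqueFilling A p (slotColoring A p slot e) := by
  have hsymm : ∀ j a b, slotColoring A p slot e j a b → slotColoring A p slot e j b a := by
    rintro j a b (⟨rfl, h⟩ | ⟨hne, h | h | ⟨t, h₁, h₂, h₃, h₄⟩⟩)
    · exact Or.inl ⟨rfl, h⟩
    · exact Or.inr ⟨hne.symm, Or.inr (Or.inl h)⟩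
    · exact Or.inr ⟨hne.symm, Or.inl h⟩
    · exact Or.inr ⟨hne.symm, Or.inr (Or.inr ⟨t, h₁, h₃, h₂, by rwa [add_comm]⟩)⟩
  have hout : ∀ j a b, a ∉ A → slotColoring A p slot e j a b → p j a ∨ slot j = Sum.inl a := by
    rintro j a b ha (⟨rfl, h⟩ | ⟨hne, h | h | ⟨t, h₁, h₂, h₃, h₄⟩⟩)
    · exact Or.inl h
    · exact Or.inl (h.2.resolve_left ha)
    · exact Or.inr h.1
    · exact absurd h₂ ha
  have hdisj : ∀ j j' a b b', a ∉ A → slotColoring A p slot e j a b →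
      slotColoring A p slot e j' a b' → j = j' := by
    intro j j' a b b' ha h h'
    rcases hout _ _ _ ha h with h | h <;> rcases hout _ _ _ ha h' with h' | h'
    · exact hp _ _ _ h h'
    · exact (hs.inl _ _ h').2 _ h
    · exact ((hs.inl _ _ h).2 _ h').symm
    · exact hs.inj (h.trans h'.symm)
  refine ⟨hsymm, ?_, ?_, hdisj, ?_⟩
  · intro j a
    simp [slotColoring]
  · intro j j' a b h h'
    by_cases ha : a ∈ A
    swap
    · exact hdisj _ _ _ _ _ ha h h'
    by_cases hb : b ∈ A
    swap
    · exact hdisj _ _ _ _ _ hb (hsymm _ _ _ h) (hsymm _ _ _ h')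
    have key : ∀ j, slotColoring A p slot e j a b → (a = b ∧ p j a) ∨ (a ≠ b ∧
        ∃ t : Fin (A.card / 2), slot j = Sum.inr t ∧ (e a + e b) % A.card / 2 = t) := by
      rintro j (h | ⟨hne, h | h | ⟨t, h₁, h₂, h₃, h₄⟩⟩)
      · exact Or.inl h
      · exact absurd hb (hs.inl _ _ h.1).1
      · exact absurd ha (hs.inl _ _ h.1).1
      · exact Or.inr ⟨hne, t, h₁, h₄⟩
    rcases key j h with ⟨hab, h⟩ | ⟨hab, t, h, ht⟩ <;>
      rcases key j' h' with ⟨hab', h'⟩ | ⟨hab', t', h', ht'⟩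
    · exact hp _ _ _ h h'
    · exact absurd hab hab'
    · exact absurd hab' hab
    · have : t = t' := Fin.ext (ht.symm.trans ht')
      exact hs.inj (by rw [h, h', this])
  · intro j x y hx hy
    cases hj : slot j with
    | inl q =>
      have hq : ∀ x, (x ∈ A ∨ p j x) → ReflTransGen (slotColoring A p slot e j) x q ∧
          ReflTransGen (slotColoring A p slot e j) q x := by
        intro x hx
        by_cases hxq : x = q
        · subst hxq
          exact ⟨.refl, .refl⟩
        · have : slotColoring A p slot e j x q := Or.inr ⟨hxq, Or.inl ⟨hj, hx⟩⟩
          exact ⟨.single this, .single (hsymm _ _ _ this)⟩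
      exact (hq x hx).1.trans (hq y hy).2
    | inr t =>
      have hA : ∀ x, (x ∈ A ∨ p j x) → x ∈ A := fun x hx => hx.elim id (hs.inr _ _ hj x)
      exact he.zigzag t.2 (fun a ha b hb hab h => Or.inr ⟨hab, Or.inr (Or.inr ⟨t, hj, ha, hb, h⟩)⟩)
        (hA x hx) (hA y hy)

/-- Connectors can be assigned when there are enough of them for the colours without a port
outside `A`. -/
theorem exists_isSlotting {ℓ m : ℕ} {A : Finset (Fin ℓ)} {p : Fin m → Fin ℓ → Prop}
    (hp : ∀ j j' a, p j a → p j' a → j = j') {O : Finset (Fin ℓ)} {B : Finset (Fin m)}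
    (hO : ∀ b, b ∈ O ↔ b ∉ A ∧ ∃ j, p j b) (hB : ∀ j, j ∈ B ↔ ∀ b, p j b → b ∈ A)
    (hcard : B.card + O.card ≤ ℓ - (A.card + 1) / 2) :
    ∃ slot : Fin m → Fin ℓ ⊕ Fin (A.card / 2), IsSlotting A p slot := by
  classical
  -- The spare connectors: hubs without a coloured port, and all zigzags. They go to the colours in
  -- `B`.
  set C : Finset (Fin ℓ ⊕ Fin (A.card / 2)) := (A ∪ O)ᶜ.disjSum Finset.univ with hC
  have hAl : A.card ≤ ℓ := by simpa using A.card_le_univ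
  have hle : B.card ≤ C.card := by
    have h₁ : (A ∪ O).card = A.card + O.card := by
      apply Finset.card_union_of_disjoint
      rw [Finset.disjoint_left]
      exact fun a ha hO' => ((hO a).1 hO').1 ha
    have h₂ : (A ∪ O).card ≤ ℓ := by simpa using (A ∪ O).card_le_univ
    rw [hC, Finset.card_disjSum, Finset.card_compl, h₁]
    simp
    omega
  obtain ⟨f⟩ : Nonempty (B ↪ C) := Function.Embedding.nonempty_of_card_le (by simpa using hle)
  have hgood : ∀ j, j ∉ B → ∃ b, p j b ∧ b ∉ A := by
    intro j hj
    rw [hB] at hj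
    push Not at hj
    exact hj
  choose g hg hgA using hgood
  have hfB : ∀ (x : B) b, (f x : Fin ℓ ⊕ Fin (A.card / 2)) = Sum.inl b → b ∉ A ∧ b ∉ O := by
    intro x b h
    have := (f x).2
    rw [h, hC] at this
    simpa using this
  refine ⟨fun j => if h : j ∈ B then (f ⟨j, h⟩ : Fin ℓ ⊕ Fin (A.card / 2)) else Sum.inl (g j h),
    ?_, ?_, ?_⟩
  · intro j j' hjj
    by_cases h : j ∈ B <;> by_cases h' : j' ∈ B <;> simp only [h, h', dif_pos, dif_neg,
      not_false_eq_true] at hjj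
    · exact congrArg Subtype.val (f.injective (Subtype.ext hjj))
    · exact absurd ((hO _).2 ⟨hgA _ h', _, hg _ h'⟩) (hfB _ _ hjj).2
    · exact absurd ((hO _).2 ⟨hgA _ h, _, hg _ h⟩) (hfB _ _ hjj.symm).2
    · have := hg _ h
      rw [Sum.inl.inj hjj] at this
      exact hp _ _ _ this (hg _ h')
  · intro j b hjb
    by_cases h : j ∈ B <;> simp only [h, dif_pos, dif_neg, not_false_eq_true] at hjb
    · refine ⟨(hfB _ _ hjb).1, fun j' hj' => ?_⟩
      exact absurd ((hO _).2 ⟨(hfB _ _ hjb).1, _, hj'⟩) (hfB _ _ hjb).2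
    · cases hjb
      exact ⟨hgA _ h, fun j' hj' => hp _ _ _ hj' (hg _ h)⟩
  · intro j t hjt
    by_cases h : j ∈ B <;> simp only [h, dif_pos, dif_neg, not_false_eq_true] at hjt
    · exact (hB j).1 h
    · cases hjt

/-- A vertex of `A` keeps an uncoloured edge or port if a connector is unused, or its port is
uncoloured, or `A` is odd and the port of the vertex in the middle of the numbering is
uncoloured. -/
theorem IsSlotting.exists_free {ℓ m : ℕ} {A : Finset (Fin ℓ)} {p : Fin m → Fin ℓ → Prop}
    {slot : Fin m → Fin ℓ ⊕ Fin (A.card / 2)} (hs : IsSlotting A p slot) {e : Fin ℓ → ℕ}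
    (he : IsNumbering A A.card e) (hA : 2 ≤ A.card) {a₀ : Fin ℓ} (ha₀ : a₀ ∈ A)
    (hea : e a₀ = A.card / 2)
    (h : m < ℓ - (A.card + 1) / 2 ∨ (∀ j, ∀ a ∈ A, ¬ p j a) ∨
      (A.card % 2 = 1 ∧ ∀ j, ¬ p j a₀)) {a : Fin ℓ} (ha : a ∈ A) :
    ∃ b, ∀ j, ¬ slotColoring A p slot e j a b := by
  classical
  have hAl : A.card ≤ ℓ := by simpa using A.card_le_univ
  rcases h with h | h | ⟨hodd, h⟩
  · have hex : ∃ x ∈ (Aᶜ.disjSum Finset.univ : Finset (Fin ℓ ⊕ Fin (A.card / 2))),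
        x ∉ Finset.univ.image slot := by
      by_contra! hcon
      have h₁ := Finset.card_le_card (show (Aᶜ.disjSum Finset.univ :
        Finset (Fin ℓ ⊕ Fin (A.card / 2))) ⊆ Finset.univ.image slot from hcon)
      have h₂ := Finset.card_image_le (s := Finset.univ) (f := slot)
      rw [Finset.card_disjSum, Finset.card_compl] at h₁
      simp at h₁ h₂
      omega
    obtain ⟨x, hx, hx'⟩ := hex
    have hx' : ∀ j, slot j ≠ x := fun j hj => hx' (by simp [← hj])
    cases x with
    | inl q =>
      have hq : q ∉ A := by simpa using hx
      refine ⟨q, fun j hj => ?_⟩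
      rcases hj with ⟨rfl, -⟩ | ⟨-, h | h | ⟨t, -, -, h, -⟩⟩
      · exact hq ha
      · exact hx' j h.1
      · exact (hs.inl _ _ h.1).1 ha
      · exact hq h
    | inr t =>
      have ht := t.2
      obtain ⟨b, hb, hne, hbt⟩ : ∃ b ∈ A, a ≠ b ∧ (e a + e b) % A.card / 2 = t := by
        obtain ⟨c, hc, hc', hc''⟩ := he.exists_partner ha (v := 2 * t) (by omega)
        obtain ⟨d, hd, hd', hd''⟩ := he.exists_partner ha (v := 2 * t + 1) (by omega)
        -- If `a` is its own partner for the sum `2t`, its partner for `2t + 1` is another vertex.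
        by_cases hac : a = c
        · refine ⟨d, hd, ?_, by omega⟩
          rintro rfl
          subst hac
          omega
        · exact ⟨c, hc, hac, by omega⟩
      refine ⟨b, fun j hj => ?_⟩
      rcases hj with ⟨rfl, -⟩ | ⟨-, h | h | ⟨t', h', -, -, h⟩⟩
      · exact hne rfl
      · exact (hs.inl _ _ h.1).1 hb
      · exact (hs.inl _ _ h.1).1 ha
      · exact hx' j (h'.trans (congrArg _ (Fin.ext (h.symm.trans hbt))))
  · exact ⟨a, fun j hj => h j a ha (slotColoring_self.1 hj)⟩
  · by_cases haa : a = a₀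
    · exact ⟨a, fun j hj => h j (haa ▸ slotColoring_self.1 hj)⟩
    -- For odd `|A|` the residue `|A| - 1` belongs to no zigzag, so the edges with this sum are
    -- uncoloured. They match up all of `A` except the vertex numbered `|A| / 2`, which is `a₀`.
    · obtain ⟨b, hb, hb', hb''⟩ := he.exists_partner ha (v := A.card - 1) (by omega)
      have hne : a ≠ b := by
        rintro rfl
        refine haa (he.inj _ ha _ ha₀ ?_)
        have := he.lt _ ha
        omega
      refine ⟨b, fun j hj => ?_⟩
      rcases hj with ⟨rfl, -⟩ | ⟨-, h | h | ⟨t', h', -, -, h⟩⟩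
      · exact hne rfl
      · exact (hs.inl _ _ h.1).1 hb
      · exact (hs.inl _ _ h.1).1 ha
      · have := t'.2
        omega

open Classical in
/-- A clique can be filled so that every terminal keeps an uncoloured edge or port. -/
theorem exists_isCliqueFilling_free {ℓ m : ℕ} {A : Finset (Fin ℓ)} {p : Fin m → Fin ℓ → Prop}
    (hp : ∀ j j' a, p j a → p j' a → j = j') (hA : A.Nonempty) (hfree : ∃ i, ∀ j, ¬ p j i)
    (h : 2 ≤ A.card →
      (Finset.univ.filter fun j => ∀ b, p j b → b ∈ A).card +
          (Finset.univ.filter fun b => b ∉ A ∧ ∃ j, p j b).card ≤ ℓ - (A.card + 1) / 2 ∧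
      (m < ℓ - (A.card + 1) / 2 ∨ (∀ j, ∀ a ∈ A, ¬ p j a) ∨
        (A.card % 2 = 1 ∧ ∃ a ∈ A, ∀ j, ¬ p j a))) :
    ∃ c, IsCliqueFilling A p c ∧ ∀ a ∈ A, ∃ b, ∀ j, ¬ c j a b := by
  by_cases hA2 : 2 ≤ A.card
  · obtain ⟨hcard, h⟩ := h hA2
    obtain ⟨slot, hs⟩ := exists_isSlotting hp (fun b => by simp) (fun j => by simp) hcard
    obtain ⟨a₀, ha₀, h⟩ : ∃ a₀ ∈ A, m < ℓ - (A.card + 1) / 2 ∨ (∀ j, ∀ a ∈ A, ¬ p j a) ∨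
        (A.card % 2 = 1 ∧ ∀ j, ¬ p j a₀) := by
      rcases h with h | h | ⟨h, a, ha, h'⟩
      · exact ⟨_, hA.choose_spec, Or.inl h⟩
      · exact ⟨_, hA.choose_spec, Or.inr (Or.inl h)⟩
      · exact ⟨a, ha, Or.inr (Or.inr ⟨h, h'⟩)⟩
    obtain ⟨e, he, hea⟩ := exists_isNumbering ha₀ (i := A.card / 2) (by omega)
    exact ⟨_, hs.isCliqueFilling he hp, fun a ha => hs.exists_free he hA2 ha₀ hea h ha⟩
  · obtain ⟨a₀, rfl⟩ := Finset.card_eq_one.1 (by have := hA.card_pos; omega : A.card = 1)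
    obtain ⟨i, hi⟩ := hfree
    refine ⟨_, isCliqueFilling_star hp, fun a ha => ⟨i, fun j hj => ?_⟩⟩
    obtain rfl : a = a₀ := by simpa using ha
    rcases hj with ⟨rfl, h⟩ | ⟨hne, h | h⟩
    exacts [hi j h, hi j h.2, hne h.1.symm]

/-! ### Counting connectors and the induction on word length -/

theorem isPortPacking_of_card_eq_one {n ℓ m : ℕ} {S : Finset (Fin n → Fin ℓ)} (hS : S.card = 1) :
    IsPortPacking S (fun (_ : Fin m) _ _ => False) := by
  obtain ⟨w, rfl⟩ := Finset.card_eq_one.1 hS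
  refine ⟨fun _ _ _ _ _ _ h => h, fun _ _ _ _ h => h.elim, fun _ _ _ _ _ _ h => h.elim, ?_⟩
  intro j x hx y hy
  rw [Finset.mem_singleton.1 hx, Finset.mem_singleton.1 hy]

theorem IsPortPacking.comp {n ℓ m m' : ℕ} {S : Finset (Fin n → Fin ℓ)}
    {U : Fin m' → (Fin n → Fin ℓ) → Fin ℓ → Prop} (hU : IsPortPacking S U) {f : Fin m → Fin m'}
    (hf : Function.Injective f) : IsPortPacking S (fun j => U (f j)) :=
  ⟨fun _ => hU.symm _, fun _ _ _ _ h h' => hf (hU.excl _ _ _ _ h h'),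
    fun _ _ _ _ _ hw h h' => hf (hU.disj _ _ _ _ _ hw h h'), fun _ => hU.conn _⟩

theorem IsPortPacking.exists_port {n ℓ m : ℕ} {S : Finset (Fin n → Fin ℓ)}
    {U : Fin m → (Fin n → Fin ℓ) → Fin ℓ → Prop} (hU : IsPortPacking S U) (hS : 2 ≤ S.card)
    {w : Fin n → Fin ℓ} (hw : w ∈ S) (j : Fin m) : ∃ i, U j w i := by
  obtain ⟨w', hw', hne⟩ := Finset.exists_mem_ne hS w
  rcases (hU.conn j w hw w' hw').cases_head with h | ⟨x, ⟨i, i', -, h⟩, -⟩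
  · exact absurd h.symm hne
  · exact ⟨i, h⟩

theorem exists_injective_ne {m m' : ℕ} (h : m < m') (j₀ : Fin m') :
    ∃ f : Fin m → Fin m', Function.Injective f ∧ ∀ j, f j ≠ j₀ := by
  obtain ⟨f⟩ : Nonempty (Fin m ↪ {j : Fin m' // j ≠ j₀}) :=
    Function.Embedding.nonempty_of_card_le (by simp; omega)
  exact ⟨fun j => f j, Subtype.val_injective.comp f.injective, fun j => (f j).2⟩

-- Each bad colour (no port outside `A`) and each discarded colour owns a port. These ports are
-- distinct, none of them is a retained colour's port outside `A`, and `i₀` is a further one.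
open Classical in
theorem card_bad_add_card_outer_le {ℓ m m' : ℕ} {p : Fin m' → Fin ℓ → Prop}
    (hp : ∀ j j' a, p j a → p j' a → j = j') (hne : ∀ j, ∃ a, p j a) {i₀ : Fin ℓ}
    (hi₀ : ∀ j, ¬ p j i₀) {f : Fin m → Fin m'} (hf : Function.Injective f) (A : Finset (Fin ℓ)) :
    (Finset.univ.filter fun j => ∀ b, p (f j) b → b ∈ A).card +
      (Finset.univ.filter fun b => b ∉ A ∧ ∃ j, p (f j) b).card + (m' - m) + 1 ≤ ℓ := by
  set B := Finset.univ.filter fun j => ∀ b, p (f j) b → b ∈ A with hB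
  set O := Finset.univ.filter fun b => b ∉ A ∧ ∃ j, p (f j) b with hO
  choose g hg using hne
  have hginj : Function.Injective g := fun j j' h => hp _ _ _ (hg j) (h ▸ hg j')
  set X := (B.image f ∪ (Finset.univ.image f)ᶜ).image g with hX
  have hXcard : X.card = B.card + (m' - m) := by
    rw [hX, Finset.card_image_of_injective _ hginj, Finset.card_union_of_disjoint,
      Finset.card_image_of_injective _ hf, Finset.card_compl,
      Finset.card_image_of_injective _ hf]
    · simp
    · rw [Finset.disjoint_left]
      intro x hx hx'
      obtain ⟨j, -, rfl⟩ := Finset.mem_image.1 hx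
      simp at hx'
  have hdisj : Disjoint X O := by
    rw [Finset.disjoint_left]
    intro x hx hxO
    obtain ⟨j, hj, rfl⟩ := Finset.mem_image.1 hx
    obtain ⟨hA, i, hi⟩ : g j ∉ A ∧ ∃ i, p (f i) (g j) := by simpa [hO] using hxO
    obtain rfl := hp _ _ _ hi (hg j)
    rcases Finset.mem_union.1 hj with hj | hj
    · obtain ⟨i', hi', h⟩ := Finset.mem_image.1 hj
      obtain rfl := hf h
      exact hA ((Finset.mem_filter.1 hi').2 _ hi)
    · simp at hj
  have hnot : i₀ ∉ X ∪ O := by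
    intro h
    rcases Finset.mem_union.1 h with h | h
    · obtain ⟨j, -, h⟩ := Finset.mem_image.1 h
      exact hi₀ j (h ▸ hg j)
    · obtain ⟨-, j, hj⟩ := (Finset.mem_filter.1 h).2
      exact hi₀ _ hj
  have := (insert i₀ (X ∪ O)).card_le_univ
  rw [Finset.card_insert_of_notMem hnot, Finset.card_union_of_disjoint hdisj, hXcard] at this
  simp at this
  omega

theorem card_eq_sum_cliqueTerminals {n ℓ : ℕ} (S : Finset (Fin (n + 1) → Fin ℓ)) :
    S.card = ∑ w ∈ S.image Fin.init, (cliqueTerminals S w).card := by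
  classical
  rw [Finset.card_eq_sum_card_image Fin.init S]
  refine Finset.sum_congr rfl fun w _ => ?_
  refine Finset.card_bij (fun u _ => u (Fin.last n)) ?_ ?_ ?_
  · intro u hu
    obtain ⟨hu', rfl⟩ := Finset.mem_filter.1 hu
    exact mem_cliqueTerminals_init.2 hu'
  · intro u hu v hv h
    obtain ⟨hu, rfl⟩ := Finset.mem_filter.1 hu
    obtain ⟨hv, h'⟩ := Finset.mem_filter.1 hv
    rw [← Fin.snoc_init_self u, ← Fin.snoc_init_self v, h', h]
  · intro a ha
    exact ⟨Fin.snoc w a, by simpa [cliqueTerminals] using ha, by simp⟩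

theorem cliqueTerminals_nonempty {n ℓ : ℕ} {S : Finset (Fin (n + 1) → Fin ℓ)} {w : Fin n → Fin ℓ}
    (hw : w ∈ S.image Fin.init) : (cliqueTerminals S w).Nonempty := by
  obtain ⟨u, hu, rfl⟩ := Finset.mem_image.1 hw
  exact ⟨_, mem_cliqueTerminals_init.2 hu⟩

theorem cliqueTerminals_eq_empty {n ℓ : ℕ} {S : Finset (Fin (n + 1) → Fin ℓ)} {w : Fin n → Fin ℓ}
    (hw : w ∉ S.image Fin.init) : cliqueTerminals S w = ∅ := by
  refine Finset.eq_empty_of_forall_notMem fun a ha => hw ?_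
  exact Finset.mem_image.2 ⟨Fin.snoc w a, by simpa [cliqueTerminals] using ha, by simp⟩

/-- Every other clique that meets `S` contains at least one terminal. -/
theorem card_cliqueTerminals_add_card_image_le {n ℓ : ℕ} {S : Finset (Fin (n + 1) → Fin ℓ)}
    {w : Fin n → Fin ℓ} (hw : w ∈ S.image Fin.init) :
    (cliqueTerminals S w).card + (S.image Fin.init).card ≤ S.card + 1 := by
  have h₁ := card_eq_sum_cliqueTerminals S
  rw [← Finset.add_sum_erase _ _ hw] at h₁
  have h₂ := Finset.card_nsmul_le_sum ((S.image Fin.init).erase w)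
    (fun w => (cliqueTerminals S w).card) 1
    (fun x hx => (cliqueTerminals_nonempty (Finset.mem_of_mem_erase hx)).card_pos)
  have h₃ := Finset.card_erase_add_one hw
  rw [smul_eq_mul, mul_one] at h₂
  omega

theorem card_cliqueTerminals_add_le {n ℓ : ℕ} {S : Finset (Fin (n + 1) → Fin ℓ)}
    {w w' : Fin n → Fin ℓ} (hw : w ∈ S.image Fin.init) (hw' : w' ∈ S.image Fin.init)
    (hne : w ≠ w') :
    (cliqueTerminals S w).card + (cliqueTerminals S w').card ≤ S.card := by
  have h₁ := card_eq_sum_cliqueTerminals S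
  rw [← Finset.add_sum_erase _ _ hw] at h₁
  have h₂ := Finset.single_le_sum (s := (S.image Fin.init).erase w)
    (f := fun w => (cliqueTerminals S w).card) (fun _ _ => Nat.zero_le _)
    (Finset.mem_erase.2 ⟨hne.symm, hw'⟩)
  omega

open Classical in
/-- The packing for the projected terminals, thinned out to the number of colours that is needed
one level up, satisfies the conditions for filling every clique. -/
theorem exists_thinned_packing {n ℓ : ℕ} {S : Finset (Fin (n + 1) → Fin ℓ)} (hS : S.Nonempty)
    (hcard : S.card ≤ ℓ)
    (ih : ∀ S : Finset (Fin n → Fin ℓ), S.Nonempty → S.card ≤ ℓ →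
      ∃ U : Fin (ℓ - (S.card + 1) / 2) → (Fin n → Fin ℓ) → Fin ℓ → Prop,
        IsPortPacking S U ∧ ∀ w ∈ S, ∃ i, ∀ j, ¬ U j w i) :
    ∃ U : Fin (ℓ - (S.card + 1) / 2) → (Fin n → Fin ℓ) → Fin ℓ → Prop,
      IsPortPacking (S.image Fin.init) U ∧ ∀ w ∈ S.image Fin.init, (∃ i, ∀ j, ¬ U j w i) ∧
        (2 ≤ (cliqueTerminals S w).card →
          (Finset.univ.filter fun j => ∀ b, U j w b → b ∈ cliqueTerminals S w).card +
            (Finset.univ.filter fun b => b ∉ cliqueTerminals S w ∧ ∃ j, U j w b).card ≤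
              ℓ - ((cliqueTerminals S w).card + 1) / 2 ∧
          (ℓ - (S.card + 1) / 2 < ℓ - ((cliqueTerminals S w).card + 1) / 2 ∨
            (∀ j, ∀ a ∈ cliqueTerminals S w, ¬ U j w a) ∨
            ((cliqueTerminals S w).card % 2 = 1 ∧
              ∃ a ∈ cliqueTerminals S w, ∀ j, ¬ U j w a))) := by
  have hpos := hS.card_pos
  have hS'pos : 0 < (S.image Fin.init).card := (hS.image _).card_pos
  have hS'le : (S.image Fin.init).card ≤ S.card := Finset.card_image_le
  by_cases hone : (S.image Fin.init).card = 1
  -- All terminals lie in one clique, and no colour has to leave it.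
  · refine ⟨_, isPortPacking_of_card_eq_one hone, fun w hw => ⟨⟨⟨0, by omega⟩, by simp⟩,
      fun h2 => ⟨?_, Or.inr (Or.inl (by simp))⟩⟩⟩
    have := card_cliqueTerminals_add_card_image_le hw
    simp
    omega
  obtain ⟨U, hU, hfree⟩ := ih (S.image Fin.init) (hS.image _) (hS'le.trans hcard)
  have hcount : ∀ f : Fin (ℓ - (S.card + 1) / 2) → Fin (ℓ - ((S.image Fin.init).card + 1) / 2),
      Function.Injective f → ∀ w ∈ S.image Fin.init, 2 ≤ (cliqueTerminals S w).card →
      (Finset.univ.filter fun j => ∀ b, U (f j) w b → b ∈ cliqueTerminals S w).card +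
        (Finset.univ.filter fun b => b ∉ cliqueTerminals S w ∧ ∃ j, U (f j) w b).card ≤
          ℓ - ((cliqueTerminals S w).card + 1) / 2 := by
    intro f hf w hw h2
    obtain ⟨i₀, hi₀⟩ := hfree w hw
    have h₁ := card_bad_add_card_outer_le (p := fun j => U j w) (fun j j' a => hU.excl j j' w a)
      (hU.exists_port (by omega) hw) hi₀ hf (cliqueTerminals S w)
    have h₂ := card_cliqueTerminals_add_card_image_le hw
    -- The surplus of colours plus one is at least `⌈|A|/2⌉`, by `h₂`; the extra one is the free
    -- port `i₀`.
    omega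
  by_cases htight : ∃ w ∈ S.image Fin.init, 2 ≤ (cliqueTerminals S w).card ∧
      ¬ (ℓ - (S.card + 1) / 2 < ℓ - ((cliqueTerminals S w).card + 1) / 2) ∧
      ∃ a ∈ cliqueTerminals S w, ∃ j, U j w a
  -- Here all connectors at `w` are in use. This forces `|S'| = 2` and `|A| = |S| - 1` odd, so some
  -- colour must be discarded anyway; discarding `j₀` frees the port `a`.
  · obtain ⟨w, hw, h2, hnlt, a, ha, j₀, hj₀⟩ := htight
    have h₁ := card_cliqueTerminals_add_card_image_le hw
    obtain ⟨f, hf, hfj⟩ := exists_injective_ne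
      (show ℓ - (S.card + 1) / 2 < ℓ - ((S.image Fin.init).card + 1) / 2 by omega) j₀
    refine ⟨_, hU.comp hf, fun w' hw' => ⟨?_, fun h2' => ⟨hcount f hf w' hw' h2', ?_⟩⟩⟩
    · obtain ⟨i, hi⟩ := hfree w' hw'
      exact ⟨i, fun j => hi _⟩
    · by_cases hww : w = w'
      · subst hww
        exact Or.inr (Or.inr ⟨by omega, a, ha, fun j hj => hfj j (hU.excl _ _ _ _ hj hj₀)⟩)
      -- The other clique has at most one terminal, contrary to `h2'`.
      · have := card_cliqueTerminals_add_le hw hw' hww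
        left
        omega
  · have hle : ℓ - (S.card + 1) / 2 ≤ ℓ - ((S.image Fin.init).card + 1) / 2 := by omega
    refine ⟨_, hU.comp (Fin.castLE_injective hle),
      fun w hw => ⟨?_, fun h2 => ⟨hcount _ (Fin.castLE_injective hle) w hw h2, ?_⟩⟩⟩
    · obtain ⟨i, hi⟩ := hfree w hw
      exact ⟨i, fun j => hi _⟩
    · by_cases hlt : ℓ - (S.card + 1) / 2 < ℓ - ((cliqueTerminals S w).card + 1) / 2
      · exact Or.inl hlt
      · exact Or.inr (Or.inl fun j a ha hj => htight ⟨w, hw, h2, hlt, a, ha, _, hj⟩)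

theorem exists_isPortPacking_free {n ℓ : ℕ} : ∀ S : Finset (Fin n → Fin ℓ), S.Nonempty →
    S.card ≤ ℓ → ∃ U : Fin (ℓ - (S.card + 1) / 2) → (Fin n → Fin ℓ) → Fin ℓ → Prop,
      IsPortPacking S U ∧ ∀ w ∈ S, ∃ i, ∀ j, ¬ U j w i := by
  classical
  induction n with
  | zero =>
    intro S hS hcard
    have hpos := hS.card_pos
    refine ⟨_, isPortPacking_of_card_eq_one ?_, fun w hw => ⟨⟨0, by omega⟩, by simp⟩⟩
    exact le_antisymm (by simpa using S.card_le_univ) hpos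
  | succ n ih =>
    intro S hS hcard
    obtain ⟨U, hU, h⟩ := exists_thinned_packing hS hcard ih
    have hfill : ∀ w, ∃ c, IsCliqueFilling (cliqueTerminals S w) (fun j => U j w) c ∧
        ∀ a ∈ cliqueTerminals S w, ∃ b, ∀ j, ¬ c j a b := by
      intro w
      by_cases hw : w ∈ S.image Fin.init
      · exact exists_isCliqueFilling_free (fun j j' a => hU.excl j j' w a)
          (cliqueTerminals_nonempty hw) (h w hw).1 (h w hw).2
      -- A vertex outside the projection carries at most one colour, which may take all edges
      -- between its ports.
      · refine ⟨_, isCliqueFilling_complete (cliqueTerminals_eq_empty hw)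
          (fun j j' a b => hU.disj j j' w a b hw), ?_⟩
        rw [cliqueTerminals_eq_empty hw]
        simp
    choose c hc hcfree using hfill
    refine ⟨_, hU.lift (fun u hu => Finset.mem_image_of_mem _ hu) hc, fun u hu => ?_⟩
    exact hcfree _ _ (mem_cliqueTerminals_init.2 hu)

/-- The Sierpiński graph has `ℓ / 2` edge-disjoint connected spanning subgraphs. -/
theorem exists_isPortPacking_univ {n ℓ : ℕ} :
    ∃ U : Fin (ℓ / 2) → (Fin n → Fin ℓ) → Fin ℓ → Prop, IsPortPacking Finset.univ U := by
  induction n with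
  | zero => exact ⟨_, isPortPacking_of_card_eq_one (by simp)⟩
  | succ n ih =>
    obtain ⟨U, hU⟩ := ih
    -- In every clique the colour `j` takes the `j`-th zigzag, with the letters numbered by their
    -- values.
    refine ⟨_, hU.lift (S := Finset.univ) (fun _ _ => Finset.mem_univ _)
      (c := fun w j a b => (a = b ∧ U j w a) ∨ (a ≠ b ∧ ((a : ℕ) + b) % ℓ / 2 = j)) fun w => ?_⟩
    have huniv : cliqueTerminals (Finset.univ : Finset (Fin (n + 1) → Fin ℓ)) w = Finset.univ := by
      simp [cliqueTerminals]
    rw [huniv]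
    refine ⟨?_, by simp, ?_, by simp, ?_⟩
    · rintro j a b (⟨rfl, h⟩ | ⟨hne, h⟩)
      · exact Or.inl ⟨rfl, h⟩
      · exact Or.inr ⟨hne.symm, by rwa [add_comm]⟩
    · rintro j j' a b (⟨rfl, h⟩ | ⟨hne, h⟩) (⟨h₁, h'⟩ | ⟨hne', h'⟩)
      · exact hU.excl _ _ _ _ h h'
      · exact absurd rfl hne'
      · exact absurd h₁ hne
      · exact Fin.ext (h.symm.trans h')
    · intro j x y _ _
      have he : IsNumbering (Finset.univ : Finset (Fin ℓ)) ℓ Fin.val :=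
        ⟨fun a _ => a.2, fun a _ b _ h => Fin.ext h, fun i hi => ⟨⟨i, hi⟩, Finset.mem_univ _, rfl⟩⟩
      exact he.zigzag j.2 (fun a _ b _ hab h => Or.inr ⟨hab, h⟩) (Finset.mem_univ x)
        (Finset.mem_univ y)

/-! ### From port packings to Steiner trees: the lower bounds -/

/-- If a subgraph of `G` on the same vertices connects `S`, then `G` has an `S`-Steiner tree
spanning the component that contains `S`. -/
theorem exists_isSteinerTree_of_reachable {V : Type*} [Finite V] {G H : SimpleGraph V}
    (hH : H ≤ G) {S : Finset V} {x : V} (hS : ∀ y ∈ S, H.Reachable x y) :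
    ∃ T : G.Subgraph, IsSteinerTree G S T ∧ (∀ v, v ∈ T.verts ↔ H.Reachable x v) ∧
      ∀ u v, T.Adj u v → H.Adj u v := by
  set C := H.connectedComponentMk x with hC
  have hmem : ∀ v, v ∈ C.supp ↔ H.Reachable x v := fun v => by
    rw [hC, SimpleGraph.ConnectedComponent.mem_supp_iff, SimpleGraph.ConnectedComponent.eq]
    exact SimpleGraph.reachable_comm
  obtain ⟨T₀, hle, hT₀⟩ := (C.connected_toSimpleGraph).exists_isTree_le
  let T : G.Subgraph :=
    { verts := C.supp
      Adj := fun u v => ∃ (hu : u ∈ C.supp) (hv : v ∈ C.supp), T₀.Adj ⟨u, hu⟩ ⟨v, hv⟩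
      adj_sub := fun ⟨hu, hv, h⟩ => hH (hle h)
      edge_vert := fun ⟨hu, _, _⟩ => hu
      symm := ⟨fun _ _ ⟨hu, hv, h⟩ => ⟨hv, hu, h.symm⟩⟩ }
  have hT : T.coe = T₀ := by
    ext u v
    exact ⟨fun ⟨_, _, h⟩ => h, fun h => ⟨u.2, v.2, h⟩⟩
  refine ⟨T, ⟨by rw [hT]; exact hT₀, fun y hy => (hmem y).2 (hS y hy)⟩, hmem,
    fun u v ⟨_, _, h⟩ => hle h⟩

theorem IsPortPacking.exists_internallyDisjointTrees {n ℓ m : ℕ} {S : Finset (Fin n → Fin ℓ)}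
    {U : Fin m → (Fin n → Fin ℓ) → Fin ℓ → Prop} (hU : IsPortPacking S U) (hS : S.Nonempty) :
    ∃ T : Fin m → (sierpinskiGraph n ℓ).Subgraph,
      InternallyDisjointTrees (sierpinskiGraph n ℓ) S T := by
  obtain ⟨x, hx⟩ := hS
  let H : Fin m → SimpleGraph (Fin n → Fin ℓ) := fun j =>
    { Adj := PortStep (U j)
      symm := ⟨fun _ _ ⟨i, i', h, h'⟩ => ⟨i', i, h.symm, hU.symm _ _ _ _ _ h h'⟩⟩
      loopless := ⟨fun _ ⟨_, _, h, _⟩ => h.adj.ne rfl⟩ }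
  have hH : ∀ j, H j ≤ sierpinskiGraph n ℓ := fun j u v ⟨_, _, h, _⟩ => h.adj
  have hreach : ∀ j, ∀ y ∈ S, (H j).Reachable x y := fun j y hy =>
    (SimpleGraph.reachable_iff_reflTransGen _ _).2 (hU.conn j x hx y hy)
  choose T hT hverts hadj using fun j => exists_isSteinerTree_of_reachable (hH j) (hreach j)
  -- A tree vertex other than `x` is joined to `x` by a path, whose edge at `v` uses a port.
  have hport : ∀ j v, v ∉ S → v ∈ (T j).verts → ∃ i, U j v i := by
    intro j v hv hvT
    have h := (SimpleGraph.reachable_iff_reflTransGen _ _).1 ((hverts j v).1 hvT).symm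
    rcases h.cases_head with h | ⟨y, ⟨i, _, _, hi⟩, _⟩
    · exact absurd (h ▸ hx) hv
    · exact ⟨i, hi⟩
  refine ⟨T, hT, fun i j hij => ⟨?_, ?_⟩⟩
  · refine Set.eq_empty_of_forall_notMem fun e he => ?_
    induction e using Sym2.ind with
    | _ u v =>
      obtain ⟨a, a', ha, hua⟩ := hadj i u v (SimpleGraph.Subgraph.mem_edgeSet.1 he.1)
      obtain ⟨b, b', hb, hub⟩ := hadj j u v (SimpleGraph.Subgraph.mem_edgeSet.1 he.2)
      obtain rfl := ha.eq_of_eq hb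
      exact hij (hU.excl _ _ _ _ hua hub)
  · refine Set.Subset.antisymm (fun v hv => ?_) (Set.subset_inter (hT i).2 (hT j).2)
    by_contra hvS
    obtain ⟨a, ha⟩ := hport i v hvS hv.1
    obtain ⟨b, hb⟩ := hport j v hvS hv.2
    exact hij (hU.disj _ _ _ _ _ hvS ha hb)

theorem InternallyDisjointTrees.edgeDisjointTrees {V : Type*} {G : SimpleGraph V} {S : Finset V}
    {m : ℕ} {T : Fin m → G.Subgraph} (h : InternallyDisjointTrees G S T) :
    EdgeDisjointTrees G S T :=
  ⟨h.1, fun i j hij => (h.2 i j hij).1⟩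

theorem EdgeDisjointTrees.mono {V : Type*} {G : SimpleGraph V} {S S' : Finset V} (hS : S' ⊆ S)
    {m : ℕ} {T : Fin m → G.Subgraph} (h : EdgeDisjointTrees G S T) : EdgeDisjointTrees G S' T :=
  ⟨fun i => ⟨(h.1 i).1, (Finset.coe_subset.2 hS).trans (h.1 i).2⟩, h.2⟩

theorem localConn_le_localEdgeConn {V : Type*} (G : SimpleGraph V) (S : Finset V) :
    localConn G S ≤ localEdgeConn G S :=
  sSup_le_sSup fun _ ⟨m, hm, T, hT⟩ => ⟨m, hm, T, hT.edgeDisjointTrees⟩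

theorem genConn_le_genEdgeConn {V : Type*} (k : ℕ) (G : SimpleGraph V) :
    genConn k G ≤ genEdgeConn k G := by
  refine le_sInf ?_
  rintro _ ⟨S, hS, rfl⟩
  have h : genConn k G ≤ localConn G S := sInf_le ⟨S, hS, rfl⟩
  exact h.trans (localConn_le_localEdgeConn G S)

theorem le_genConn_sierpinskiGraph {n ℓ k : ℕ} (hk : 1 ≤ k) (hkℓ : k ≤ ℓ) :
    ((ℓ - (k + 1) / 2 : ℕ) : ℕ∞) ≤ genConn k (sierpinskiGraph n ℓ) := by
  refine le_sInf ?_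
  rintro _ ⟨S, rfl, rfl⟩
  have hS : S.Nonempty := Finset.card_pos.1 hk
  obtain ⟨U, hU, -⟩ := exists_isPortPacking_free S hS hkℓ
  exact le_sSup ⟨_, rfl, hU.exists_internallyDisjointTrees hS⟩

theorem le_genEdgeConn_sierpinskiGraph {n ℓ : ℕ} (hℓ : 1 ≤ ℓ) (k : ℕ) :
    ((ℓ / 2 : ℕ) : ℕ∞) ≤ genEdgeConn k (sierpinskiGraph n ℓ) := by
  refine le_sInf ?_
  rintro _ ⟨S, -, rfl⟩
  obtain ⟨U, hU⟩ := exists_isPortPacking_univ (n := n) (ℓ := ℓ)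
  obtain ⟨T, hT⟩ := hU.exists_internallyDisjointTrees ⟨fun _ => ⟨0, hℓ⟩, Finset.mem_univ _⟩
  exact le_sSup ⟨_, rfl, T, hT.edgeDisjointTrees.mono (Finset.subset_univ S)⟩

/-! ### Edge-disjoint connecting subgraphs of a complete graph -/

theorem exists_adj_dist_lt {W : Type*} {D : SimpleGraph W} {x q : W} (h : D.Reachable x q)
    (hne : x ≠ q) : ∃ y, D.Adj x y ∧ D.dist y q < D.dist x q := by
  obtain ⟨p, hp⟩ := h.exists_walk_length_eq_dist
  cases p with
  | nil => exact absurd rfl hne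
  | @cons _ y _ hxy p =>
    refine ⟨y, hxy, ?_⟩
    have := SimpleGraph.dist_le p
    rw [SimpleGraph.Walk.length_cons] at hp
    omega

open Classical in
/-- The edges of `D` inside `R`. -/
noncomputable def innerEdges {W : Type*} [Fintype W] (D : SimpleGraph W) (R : Finset W) :
    Finset (Sym2 W) :=
  D.edgeFinset.filter fun e => ∀ x ∈ e, x ∈ R

open Classical in
/-- The edges of `D` between `R` and its complement. -/
noncomputable def outerEdges {W : Type*} [Fintype W] (D : SimpleGraph W) (R : Finset W) :
    Finset (Sym2 W) :=
  D.edgeFinset.filter fun e => (∃ x ∈ e, x ∈ R) ∧ ∃ x ∈ e, x ∉ R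

/-- Assign to each vertex its first edge towards the root `q`. The distance to `q` drops along it,
so no edge is assigned from both ends. -/
theorem card_erase_le_card_innerEdges_add {W : Type*} [Fintype W] [DecidableEq W]
    {D : SimpleGraph W} {R : Finset W} {q : W} (h : ∀ x ∈ R, D.Reachable x q) :
    (R.erase q).card ≤ (innerEdges D R).card + (outerEdges D R).card := by
  classical
  have hnext : ∀ x : W, ∃ y, x ∈ R → x ≠ q → D.Adj x y ∧ D.dist y q < D.dist x q := by
    intro x
    by_cases hx : x ∈ R ∧ x ≠ q
    · obtain ⟨y, hy⟩ := exists_adj_dist_lt (h x hx.1) hx.2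
      exact ⟨y, fun _ _ => hy⟩
    · exact ⟨x, fun h₁ h₂ => absurd ⟨h₁, h₂⟩ hx⟩
  choose f hf using hnext
  refine le_trans ?_ (Finset.card_union_le _ _)
  refine Finset.card_le_card_of_injOn (fun x => s(x, f x)) ?_ ?_
  · intro x hx
    obtain ⟨hxq, hxR⟩ := Finset.mem_erase.1 (Finset.mem_coe.1 hx)
    have hadj := (hf x hxR hxq).1
    by_cases hfx : f x ∈ R
    · refine Finset.mem_coe.2 (Finset.mem_union_left _ ?_)
      simp [innerEdges, hadj, hxR, hfx]
    · refine Finset.mem_coe.2 (Finset.mem_union_right _ ?_)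
      simp [outerEdges, hadj, hxR, hfx]
  · intro x hx y hy hxy
    obtain ⟨hxq, hxR⟩ := Finset.mem_erase.1 (Finset.mem_coe.1 hx)
    obtain ⟨hyq, hyR⟩ := Finset.mem_erase.1 (Finset.mem_coe.1 hy)
    rcases Sym2.eq_iff.1 hxy with h | ⟨h₁, h₂⟩
    · exact h.1
    · have hx' := (hf x hxR hxq).2
      have hy' := (hf y hyR hyq).2
      rw [h₂] at hx'
      rw [← h₁] at hy'
      omega

/-- A graph that connects `R` has many edges at `R`; inner edges count a little more. -/
theorem mul_pred_le_weighted_edges {W : Type*} [Fintype W] {D : SimpleGraph W} {R : Finset W}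
    (h : ∀ x ∈ R, ∀ y ∈ R, D.Reachable x y) :
    R.card * (R.card - 1) ≤
      R.card * (innerEdges D R).card + (R.card - 1) * (outerEdges D R).card := by
  classical
  rcases R.eq_empty_or_nonempty with rfl | ⟨x, hx⟩
  · simp
  rcases (outerEdges D R).eq_empty_or_nonempty with hO | ⟨e, he⟩
  · have h₁ := card_erase_le_card_innerEdges_add (q := x) fun y hy => h y hy x hx
    rw [Finset.card_erase_of_mem hx, hO, Finset.card_empty, add_zero] at h₁
    rw [hO, Finset.card_empty, mul_zero, add_zero]
    exact Nat.mul_le_mul_left _ h₁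
  -- With an outer edge present, the root can be taken outside `R`; this gives `|R|` edges of weight
  -- at least `|R| - 1`, instead of `|R| - 1` inner edges of weight `|R|`.
  · obtain ⟨y, z, hy, hz, hyz⟩ : ∃ y z, y ∈ R ∧ z ∉ R ∧ D.Adj y z := by
      induction e using Sym2.ind with
      | _ a b =>
        have he := he
        simp only [outerEdges, Finset.mem_filter, SimpleGraph.mem_edgeFinset,
          SimpleGraph.mem_edgeSet, Sym2.mem_iff, exists_eq_or_imp, exists_eq_left] at he
        obtain ⟨hab, h₁ | h₁, h₂ | h₂⟩ := he
        · exact absurd h₁ h₂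
        · exact ⟨a, b, h₁, h₂, hab⟩
        · exact ⟨b, a, h₁, h₂, hab.symm⟩
        · exact absurd h₁ h₂
    have h₁ := card_erase_le_card_innerEdges_add (q := z)
      fun x hx => (h x hx y hy).trans hyz.reachable
    rw [Finset.erase_eq_of_notMem hz] at h₁
    calc R.card * (R.card - 1)
        ≤ ((innerEdges D R).card + (outerEdges D R).card) * (R.card - 1) :=
          Nat.mul_le_mul_right _ h₁
      _ = (R.card - 1) * (innerEdges D R).card + (R.card - 1) * (outerEdges D R).card := by ring
      _ ≤ _ := Nat.add_le_add_right (Nat.mul_le_mul_right _ (Nat.sub_le _ _)) _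

theorem innerEdges_mono {W : Type*} [Fintype W] {D D' : SimpleGraph W} (h : D ≤ D') {R : Finset W} :
    innerEdges D R ⊆ innerEdges D' R := by
  classical
  exact Finset.filter_subset_filter _ (SimpleGraph.edgeFinset_mono h)

theorem outerEdges_mono {W : Type*} [Fintype W] {D D' : SimpleGraph W} (h : D ≤ D') {R : Finset W} :
    outerEdges D R ⊆ outerEdges D' R := by
  classical
  exact Finset.filter_subset_filter _ (SimpleGraph.edgeFinset_mono h)

theorem card_innerEdges_top_le {W : Type*} [Fintype W] (R : Finset W) :
    (innerEdges (⊤ : SimpleGraph W) R).card ≤ R.card.choose 2 := by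
  classical
  rw [← Sym2.card_image_offDiag]
  refine Finset.card_le_card fun e he => ?_
  induction e using Sym2.ind with
  | _ a b =>
    simp only [innerEdges, Finset.mem_filter, SimpleGraph.mem_edgeFinset, SimpleGraph.mem_edgeSet,
      SimpleGraph.top_adj, Sym2.mem_iff, forall_eq_or_imp, forall_eq] at he
    exact Finset.mem_image.2 ⟨(a, b), Finset.mem_offDiag.2 ⟨he.2.1, he.2.2, he.1⟩, rfl⟩

theorem card_outerEdges_top_le {W : Type*} [Fintype W] (R : Finset W) :
    (outerEdges (⊤ : SimpleGraph W) R).card ≤ R.card * (Fintype.card W - R.card) := by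
  classical
  rw [← Finset.card_compl, ← Finset.card_product]
  refine (Finset.card_le_card fun e he => ?_).trans
    (Finset.card_image_le (f := fun x : W × W => s(x.1, x.2)))
  induction e using Sym2.ind with
  | _ a b =>
    simp only [outerEdges, Finset.mem_filter, SimpleGraph.mem_edgeFinset,
      SimpleGraph.mem_edgeSet, Sym2.mem_iff, exists_eq_or_imp, exists_eq_left] at he
    obtain ⟨-, h₁ | h₁, h₂ | h₂⟩ := he
    · exact absurd h₁ h₂
    · exact Finset.mem_image.2 ⟨(a, b), by simp [h₁, h₂], rfl⟩
    · exact Finset.mem_image.2 ⟨(b, a), by simp [h₁, h₂], Sym2.eq_swap⟩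
    · exact absurd h₁ h₂

/-- A complete graph has at most `|W| - ⌈|R| / 2⌉` edge-disjoint subgraphs that connect `R`. -/
theorem le_of_disjoint_connecting {W : Type*} [Fintype W] {m : ℕ} {D : Fin m → SimpleGraph W}
    (hdisj : ∀ i j a b, (D i).Adj a b → (D j).Adj a b → i = j) {R : Finset W} (hR : 2 ≤ R.card)
    (hconn : ∀ j, ∀ x ∈ R, ∀ y ∈ R, (D j).Reachable x y) :
    m ≤ Fintype.card W - (R.card + 1) / 2 := by
  classical
  have hdis : ∀ i j, i ≠ j → ∀ e, e ∈ (D i).edgeFinset → e ∉ (D j).edgeFinset := by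
    intro i j hij e hi hj
    induction e using Sym2.ind with
    | _ a b => exact hij (hdisj i j a b (by simpa using hi) (by simpa using hj))
  have hin : ∑ j, (innerEdges (D j) R).card ≤ R.card.choose 2 := by
    rw [← Finset.card_biUnion]
    · refine (Finset.card_le_card (Finset.biUnion_subset.2 fun j _ e he => ?_)).trans
        (card_innerEdges_top_le R)
      exact innerEdges_mono le_top he
    · intro i _ j _ hij
      refine Finset.disjoint_left.2 ?_
      exact fun e hi hj => hdis i j hij e (Finset.mem_filter.1 hi).1 (Finset.mem_filter.1 hj).1
  have hout : ∑ j, (outerEdges (D j) R).card ≤ R.card * (Fintype.card W - R.card) := by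
    rw [← Finset.card_biUnion]
    · refine (Finset.card_le_card (Finset.biUnion_subset.2 fun j _ e he => ?_)).trans
        (card_outerEdges_top_le R)
      exact outerEdges_mono le_top he
    · intro i _ j _ hij
      refine Finset.disjoint_left.2 ?_
      exact fun e hi hj => hdis i j hij e (Finset.mem_filter.1 hi).1 (Finset.mem_filter.1 hj).1
  have hsum : m * (R.card * (R.card - 1)) ≤ R.card * ∑ j, (innerEdges (D j) R).card +
      (R.card - 1) * ∑ j, (outerEdges (D j) R).card := by
    rw [Finset.mul_sum, Finset.mul_sum, ← Finset.sum_add_distrib]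
    simpa using Finset.card_nsmul_le_sum Finset.univ _ _
      fun j _ => mul_pred_le_weighted_edges (hconn j)
  have hRW : R.card ≤ Fintype.card W := R.card_le_univ
  have hch : R.card.choose 2 * 2 = R.card * (R.card - 1) := by
    rw [Nat.choose_two_right, Nat.div_mul_cancel (Nat.even_mul_pred_self _).two_dvd]
  -- With `r = |R|`, the total weight available is `r * choose r 2 + (r - 1) * r * (|W| - r)`, which
  -- is `r * (r - 1)` times `|W| - r / 2`.
  have key : R.card * (R.card - 1) * (2 * m) ≤
      R.card * (R.card - 1) * (R.card + 2 * (Fintype.card W - R.card)) := by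
    have h₁ := Nat.mul_le_mul_left R.card hin
    have h₂ := Nat.mul_le_mul_left (R.card - 1) hout
    calc R.card * (R.card - 1) * (2 * m) = 2 * (m * (R.card * (R.card - 1))) := by ring
      _ ≤ 2 * (R.card * R.card.choose 2 +
          (R.card - 1) * (R.card * (Fintype.card W - R.card))) := by omega
      _ = R.card * (R.card.choose 2 * 2) +
          2 * ((R.card - 1) * (R.card * (Fintype.card W - R.card))) := by ring
      _ = _ := by rw [hch]; ring
  have := Nat.le_of_mul_le_mul_left key (Nat.mul_pos (by omega) (by omega))
  omega

/-! ### Contracting to first letters: the upper bounds -/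

/-- Adjacent words with different first letters are determined by these letters. -/
theorem eq_of_adj_of_first_ne {n ℓ : ℕ} {u v u' v' : Fin (n + 1) → Fin ℓ}
    (h : (sierpinskiGraph (n + 1) ℓ).Adj u v) (h' : (sierpinskiGraph (n + 1) ℓ).Adj u' v')
    (hne : u 0 ≠ v 0) (hu : u 0 = u' 0) (hv : v 0 = v' 0) : u = u' ∧ v = v' := by
  have key : ∀ u v : Fin (n + 1) → Fin ℓ, (sierpinskiGraph (n + 1) ℓ).Adj u v → u 0 ≠ v 0 →
      ∀ j, j ≠ 0 → u j = v 0 ∧ v j = u 0 := by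
    rintro u v ⟨d, h₁, -, h₃⟩ hne j hj
    obtain rfl : d = 0 := by
      by_contra hd
      exact hne (h₁ 0 (Fin.pos_of_ne_zero hd))
    exact h₃ j (Fin.pos_of_ne_zero hj)
  have hne' : u' 0 ≠ v' 0 := hu ▸ hv ▸ hne
  constructor <;> funext j <;> by_cases hj : j = 0
  · rw [hj, hu]
  · rw [(key u v h hne j hj).1, (key u' v' h' hne' j hj).1, hv]
  · rw [hj, hv]
  · rw [(key u v h hne j hj).2, (key u' v' h' hne' j hj).2, hu]

/-- Edge-disjoint Steiner trees for terminals with all first letters in `R` are bounded by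
contracting the copies of the smaller Sierpiński graph. -/
theorem EdgeDisjointTrees.le_of_first_letters {n ℓ m : ℕ} {S : Finset (Fin (n + 1) → Fin ℓ)}
    {T : Fin m → (sierpinskiGraph (n + 1) ℓ).Subgraph}
    (hT : EdgeDisjointTrees (sierpinskiGraph (n + 1) ℓ) S T) {R : Finset (Fin ℓ)}
    (hR : 2 ≤ R.card) (hRS : ∀ a ∈ R, ∃ u ∈ S, u 0 = a) : m ≤ ℓ - (R.card + 1) / 2 := by
  -- The image of `T j` under the contraction, loops deleted; it need not be a tree, only connect
  -- `R`.
  let D : Fin m → SimpleGraph (Fin ℓ) := fun j =>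
    { Adj := fun a b => a ≠ b ∧ ∃ u v, (T j).Adj u v ∧ u 0 = a ∧ v 0 = b
      symm := ⟨fun _ _ ⟨hne, u, v, h, hu, hv⟩ => ⟨hne.symm, v, u, h.symm, hv, hu⟩⟩
      loopless := ⟨fun _ h => h.1 rfl⟩ }
  have hdisj : ∀ i j a b, (D i).Adj a b → (D j).Adj a b → i = j := by
    rintro i j a b ⟨hne, u, v, h, rfl, rfl⟩ ⟨-, u', v', h', hu, hv⟩
    obtain ⟨rfl, rfl⟩ := eq_of_adj_of_first_ne h.adj_sub h'.adj_sub hne hu.symm hv.symm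
    by_contra hij
    have : s(u, v) ∈ (T i).edgeSet ∩ (T j).edgeSet := ⟨h, h'⟩
    rw [hT.2 i j hij] at this
    exact this
  have hconn : ∀ j, ∀ x ∈ R, ∀ y ∈ R, (D j).Reachable x y := by
    intro j x hx y hy
    obtain ⟨u, hu, rfl⟩ := hRS x hx
    obtain ⟨v, hv, rfl⟩ := hRS y hy
    have h := (SimpleGraph.reachable_iff_reflTransGen _ _).1 ((hT.1 j).1.connected.preconnected
      ⟨u, (hT.1 j).2 hu⟩ ⟨v, (hT.1 j).2 hv⟩)
    rw [SimpleGraph.reachable_iff_reflTransGen]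
    refine ReflTransGen.lift' (fun w : (T j).verts => w.1 0) (fun a b hab => ?_) _ _ h
    change ReflTransGen _ (a.1 0) (b.1 0)
    by_cases hne : a.1 0 = b.1 0
    · rw [hne]
    · exact .single ⟨hne, a, b, hab, rfl, rfl⟩
  simpa using le_of_disjoint_connecting hdisj hR hconn

/-- The witness consists of the constant words on `r` letters, padded to `k` words. Part (i) uses `r
= k`, part (ii) uses `r = ℓ`. -/
theorem genEdgeConn_sierpinskiGraph_le {n ℓ k : ℕ} (hn : 1 ≤ n) {r : ℕ} (hr : 2 ≤ r)
    (hrℓ : r ≤ ℓ) (hrk : r ≤ k) (hk : k ≤ ℓ ^ n) :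
    genEdgeConn k (sierpinskiGraph n ℓ) ≤ ((ℓ - (r + 1) / 2 : ℕ) : ℕ∞) := by
  classical
  obtain ⟨n, rfl⟩ : ∃ n', n = n' + 1 := ⟨n - 1, by omega⟩
  obtain ⟨R, -, hR⟩ := Finset.exists_subset_card_eq
    (show r ≤ (Finset.univ : Finset (Fin ℓ)).card by simpa using hrℓ)
  have hinj : Function.Injective (fun (a : Fin ℓ) (_ : Fin (n + 1)) => a) :=
    fun a b h => congrFun h 0
  obtain ⟨S, hRS, -, hS⟩ := Finset.exists_subsuperset_card_eq
    (Finset.subset_univ (R.image fun (a : Fin ℓ) (_ : Fin (n + 1)) => a))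
    (show (R.image fun (a : Fin ℓ) (_ : Fin (n + 1)) => a).card ≤ k by
      rw [Finset.card_image_of_injective _ hinj, hR]; exact hrk)
    (by simpa using hk)
  have hle : genEdgeConn k (sierpinskiGraph (n + 1) ℓ) ≤
      localEdgeConn (sierpinskiGraph (n + 1) ℓ) S := sInf_le ⟨S, hS, rfl⟩
  refine hle.trans (sSup_le ?_)
  rintro _ ⟨m, rfl, T, hT⟩
  have := hT.le_of_first_letters (R := R) (by omega)
    fun a ha => ⟨fun _ => a, hRS (Finset.mem_image_of_mem _ ha), rfl⟩
  rw [hR] at this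
  exact_mod_cast this

theorem natCeil_div_two (k : ℕ) : ⌈(k : ℚ) / 2⌉₊ = (k + 1) / 2 := by
  refine le_antisymm (Nat.ceil_le.2 ?_) ?_
  · have h : k ≤ 2 * ((k + 1) / 2) := by omega
    have h' : (k : ℚ) ≤ 2 * (((k + 1) / 2 : ℕ) : ℚ) := by exact_mod_cast h
    linarith
  · have h := Nat.le_ceil ((k : ℚ) / 2)
    have h' : (k : ℚ) ≤ 2 * (⌈(k : ℚ) / 2⌉₊ : ℚ) := by linarith
    have h'' : k ≤ 2 * ⌈(k : ℚ) / 2⌉₊ := by exact_mod_cast h'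
    omega

theorem natFloor_div_two (k : ℕ) : ⌊(k : ℚ) / 2⌋₊ = k / 2 := by
  exact_mod_cast Nat.floor_div_eq_div (K := ℚ) k 2

end SteinerPacking

theorem theorem1p5 (n ℓ : ℕ) (hn : 1 ≤ n) (hℓ : 3 ≤ ℓ) :
    (∀ k : ℕ, 3 ≤ k → k ≤ ℓ →
      SteinerPacking.genConn k (SteinerPacking.sierpinskiGraph n ℓ) =
          ((ℓ - ⌈(k : ℚ) / 2⌉₊ : ℕ) : ℕ∞) ∧
      SteinerPacking.genEdgeConn k (SteinerPacking.sierpinskiGraph n ℓ) =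
          ((ℓ - ⌈(k : ℚ) / 2⌉₊ : ℕ) : ℕ∞)) ∧
    (∀ k : ℕ, ℓ + 1 ≤ k → k ≤ ℓ ^ n →
      SteinerPacking.genConn k (SteinerPacking.sierpinskiGraph n ℓ) ≤
          (⌊(ℓ : ℚ) / 2⌋₊ : ℕ∞) ∧
      SteinerPacking.genEdgeConn k (SteinerPacking.sierpinskiGraph n ℓ) =
          (⌊(ℓ : ℚ) / 2⌋₊ : ℕ∞)) := by
  refine ⟨fun k hk hkℓ => ?_, fun k hk hkn => ?_⟩
  · rw [SteinerPacking.natCeil_div_two]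
    have hlow := SteinerPacking.le_genConn_sierpinskiGraph (n := n) (show 1 ≤ k by omega) hkℓ
    have hmid := SteinerPacking.genConn_le_genEdgeConn k (SteinerPacking.sierpinskiGraph n ℓ)
    have hup := SteinerPacking.genEdgeConn_sierpinskiGraph_le hn (show 2 ≤ k by omega) hkℓ le_rfl
      (hkℓ.trans (Nat.le_self_pow (by omega) ℓ))
    exact ⟨le_antisymm (hmid.trans hup) hlow, le_antisymm hup (hlow.trans hmid)⟩
  · rw [SteinerPacking.natFloor_div_two]
    have hmid := SteinerPacking.genConn_le_genEdgeConn k (SteinerPacking.sierpinskiGraph n ℓ)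
    have hup := SteinerPacking.genEdgeConn_sierpinskiGraph_le hn (show 2 ≤ ℓ by omega) le_rfl
      (show ℓ ≤ k by omega) hkn
    rw [show ℓ - (ℓ + 1) / 2 = ℓ / 2 by omega] at hup
    exact ⟨hmid.trans hup,
      le_antisymm hup (SteinerPacking.le_genEdgeConn_sierpinskiGraph (by omega) k)⟩
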